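/- **Definitions.** A Hausdorff space $Y$ is *stratifiable* if to every open $U\subset Y$ one can assign a sequence $(U_n)_{n\ge 1}$ of open subsets of $Y$ such that $\overline{U_n}\subset U$, $\bigcup_n U_n=U$, and $U_n\subset V_n$ for all $n$ whenever $U\subset V$. For a topological space $X$, the *squeezed join* $SJ(X)$ is the quotient set of $X\times X\times[0,1]$ by the equivalence relation generated by $(x,y,0)\sim(x,y',0)$, $(x,y,1)\sim(x',y,1)$, $(x,x,t)\sim(x,x,t')$. Write $[x,y;t]$ for the class of $(x,y,t)$ and identify $x\in X$ with $[x,x;0]$. Basic neighbourhoods of a point $[x,y;t]\notin X$ are the sets $\{[x',y';t'] : x'\in U_x,\ y'\in U_y,\ t'\in U_t\}$, where $U_x,U_y,U_t$ are neighbourhoods of $x,y,t$. Basic neighbourhoods of $x\in X$ are the sets $\{[x',y';t'] : (x',y',t')\in U\times U\times[0,1]\,\cup\, U\times X\times[0,\varepsilon)\,\cup\, X\times U\times(1-\varepsilon,1]\}$, where $\varepsilon>0$ and $U$ is a neighbourhood of $x$ in $X$. Let $SJ^0(X)=X$, $SJ^n(X)=SJ(SJ^{n-1}(X))$ for $n\ge1$,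 and $SJ^\infty(X)=\bigcup_n SJ^n(X)$ along the inclusions $SJ^{n-1}(X)\subset SJ^n(X)$. For $a,b\in SJ^{k-1}(X)$ let $[a,b]_k=\{[a,b;t]:t\in[0,1]\}\subset SJ^k(X)$. A set $U\subset SJ^\infty(X)$ is *convex* if there is $n$ such that $[a,b]_k\subset U$ for all $k\ge n$ and all $a,b\in U\cap SJ^{k-1}(X)$. The topology of $SJ^\infty(X)$ has as base the convex sets $U$ such that $U\cap SJ^n(X)$ is open in $SJ^n(X)$ for every $n$. The *support* $\operatorname{supp}(a)\subset X$ of $a\in SJ^\infty(X)$ is defined inductively by $\operatorname{supp}(a)=\{a\}$ for $a\in X$, and $\operatorname{supp}(a)=\operatorname{supp}(x)\cup\operatorname{supp}(y)$ for $a=[x,y;t]\in SJ^n(X)\setminus SJ^{n-1}(X)$ with $x,y\in SJ^{n-1}(X)$. Finally, $\dim$ is the covering dimension: $\dim Z\le n$ means that every finite open cover of $Z$ has a finite open refinement covering $Z$ such that each point of $Z$ lies in at most $n+1$ of its members. **Lemma 3.1.** Let $Y$ be a stratifiable space and $X\subset Y$ a nonempty closed subset. Then there exist a continuous map $f:Y\to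 SJ^\infty(X)$ with $f(x)=x$ for all $x\in X$, and a map $u$ from $Y$ to the set of finite subsets of $X$ that is upper semicontinuous, i.e. $\{y\in Y: u(y)\subset U\}$ is open in $Y$ for every open $U\subset X$, such that $u(x)=\{x\}$ for all $x\in X$ and $\operatorname{supp}(f(y))\subset u(y)$ for all $y\in Y$. Moreover, $f$ and $u$ can be chosen so that, for every integer $n\ge0$ with $\dim(Y\setminus X)\le n$, one has $f(Y)\subset SJ^n(X)$. -/

import Mathlib

universe u

/-- A stratifiable space: a Hausdorff space in which every open set `U` is assigned a sequence
`S U 0, S U 1, …` of open sets with closures inside `U` and union `U`, monotonically in `U`. -/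
structure IsStratifiable (Y : Type u) [TopologicalSpace Y] : Prop where
  t2 : T2Space Y
  exists_stratification : ∃ S : TopologicalSpace.Opens Y → ℕ → TopologicalSpace.Opens Y,
    (∀ U n, closure (S U n : Set Y) ⊆ (U : Set Y)) ∧
    (∀ U, (⋃ n, (S U n : Set Y)) = (U : Set Y)) ∧
    (∀ U V, U ≤ V → ∀ n, S U n ≤ S V n)

/-- `dim Z ≤ n` for the (Čech–Lebesgue) covering dimension: every finite open cover of `Z` has a
finite open refinement such that each point lies in at most `n + 1` of its members. -/
def CoveringDimLE (Z : Type u) [TopologicalSpace Z] (n : ℕ) : Prop :=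
  ∀ 𝒰 : Set (Set Z), 𝒰.Finite → (∀ U ∈ 𝒰, IsOpen U) → ⋃₀ 𝒰 = Set.univ →
    ∃ 𝒱 : Set (Set Z), 𝒱.Finite ∧ (∀ V ∈ 𝒱, IsOpen V) ∧ ⋃₀ 𝒱 = Set.univ ∧
      (∀ V ∈ 𝒱, ∃ U ∈ 𝒰, V ⊆ U) ∧
      ∀ z : Z, {V | V ∈ 𝒱 ∧ z ∈ V}.encard ≤ (n : ℕ∞) + 1

/-- The identifications on `X × X × [0,1]` that generate the equivalence relation of the squeezed
join. -/
inductive SqueezedJoinRel (X : Type u) : X × X × unitInterval → X × X × unitInterval → Prop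
  | left (x y y' : X) : SqueezedJoinRel X (x, y, 0) (x, y', 0)
  | right (x x' y : X) : SqueezedJoinRel X (x, y, 1) (x', y, 1)
  | diag (x : X) (t t' : unitInterval) : SqueezedJoinRel X (x, x, t) (x, x, t')

/-- The squeezed join `SJ(X)` as a set: the quotient of `X × X × [0,1]` by the equivalence
relation generated by `SqueezedJoinRel`. -/
def SqueezedJoin (X : Type u) : Type u := Quot (SqueezedJoinRel X)

namespace SqueezedJoin

variable {X : Type u}

/-- The point `[x, y; t]` of the squeezed join. -/
def mk (x y : X) (t : unitInterval) : SqueezedJoin X := Quot.mk _ (x, y, t)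

/-- The inclusion `X → SJ(X)`, `x ↦ [x, x; 0]`. -/
def incl (x : X) : SqueezedJoin X := mk x x 0

open Classical in
/-- An auxiliary retraction of the set `SJ(X)` onto `X`, used to see that `incl` is injective. -/
noncomputable def retr : SqueezedJoin X → X :=
  Quot.lift (fun p => if p.2.2 = 1 then p.2.1 else p.1) (by
    rintro _ _ (⟨x, y, y'⟩ | ⟨x, x', y⟩ | ⟨x, t, t'⟩)
    · simp
    · simp
    · simp)

theorem incl_injective : Function.Injective (incl : X → SqueezedJoin X) := by
  have h : ∀ x : X, retr (incl x) = x := fun x => by simp [retr, incl, mk]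
  exact Function.LeftInverse.injective h

/-- The set `[A, B; T]` of all `[x', y'; t']` with `x' ∈ A`, `y' ∈ B`, `t' ∈ T`. -/
def box (A B : Set X) (T : Set unitInterval) : Set (SqueezedJoin X) :=
  {a | ∃ x ∈ A, ∃ y ∈ B, ∃ t ∈ T, a = mk x y t}

/-- The set `[U, ε]` of all `[x', y'; t']` with
`(x', y', t') ∈ U × U × [0,1] ∪ U × X × [0, ε) ∪ X × U × (1 - ε, 1]`. -/
def conicNhd (U : Set X) (ε : ℝ) : Set (SqueezedJoin X) :=
  box U U Set.univ ∪ box U Set.univ {t | (t : ℝ) < ε} ∪ box Set.univ U {t | 1 - ε < (t : ℝ)}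

theorem conicNhd_mono {U U' : Set X} {ε ε' : ℝ} (hU : U ⊆ U') (hε : ε ≤ ε') :
    conicNhd U ε ⊆ conicNhd U' ε' := by
  rintro a ((⟨x, hx, y, hy, t, ht, rfl⟩ | ⟨x, hx, y, hy, t, ht, rfl⟩) |
    ⟨x, hx, y, hy, t, ht, rfl⟩)
  · exact Or.inl (Or.inl ⟨x, hU hx, y, hU hy, t, ht, rfl⟩)
  · exact Or.inl (Or.inr ⟨x, hU hx, y, hy, t, lt_of_lt_of_le ht hε, rfl⟩)
  · refine Or.inr ⟨x, hx, y, hU hy, t, ?_, rfl⟩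
    have h1 : 1 - ε < (t : ℝ) := ht
    show 1 - ε' < (t : ℝ)
    linarith

theorem box_mono {A A' B B' : Set X} {T T' : Set unitInterval} (hA : A ⊆ A') (hB : B ⊆ B')
    (hT : T ⊆ T') : box A B T ⊆ box A' B' T' := by
  rintro a ⟨x, hx, y, hy, t, ht, rfl⟩
  exact ⟨x, hA hx, y, hB hy, t, hT ht, rfl⟩

/-- The topology of the squeezed join. A set is open when it contains, with each of its points,
a basic neighbourhood of that point: some `[U_x, U_y; U_t]` for a point `[x, y; t]` outside `X`,
and some `[U, ε]` for a point `x` of `X`. (For Hausdorff `X` these sets do form neighbourhood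
bases of this topology, which is then Hausdorff again.) -/
instance [TopologicalSpace X] : TopologicalSpace (SqueezedJoin X) where
  IsOpen V :=
    (∀ (x y : X) (t : unitInterval), mk x y t ∉ Set.range (incl : X → SqueezedJoin X) →
      mk x y t ∈ V → ∃ A ∈ nhds x, ∃ B ∈ nhds y, ∃ T ∈ nhds t, box A B T ⊆ V) ∧
    (∀ x : X, incl x ∈ V → ∃ U ∈ nhds x, ∃ ε : ℝ, 0 < ε ∧ conicNhd U ε ⊆ V)
  isOpen_univ :=
    ⟨fun _ _ _ _ _ => ⟨Set.univ, Filter.univ_mem, Set.univ, Filter.univ_mem, Set.univ,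
        Filter.univ_mem, Set.subset_univ _⟩,
      fun _ _ => ⟨Set.univ, Filter.univ_mem, 1, one_pos, Set.subset_univ _⟩⟩
  isOpen_inter := by
    rintro V W ⟨hV, hV'⟩ ⟨hW, hW'⟩
    refine ⟨fun x y t h hm => ?_, fun x hm => ?_⟩
    · obtain ⟨A, hA, B, hB, T, hT, h1⟩ := hV x y t h hm.1
      obtain ⟨A', hA', B', hB', T', hT', h2⟩ := hW x y t h hm.2
      exact ⟨A ∩ A', Filter.inter_mem hA hA', B ∩ B', Filter.inter_mem hB hB', T ∩ T',
        Filter.inter_mem hT hT', Set.subset_inter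
          ((box_mono Set.inter_subset_left Set.inter_subset_left Set.inter_subset_left).trans h1)
          ((box_mono Set.inter_subset_right Set.inter_subset_right
            Set.inter_subset_right).trans h2)⟩
    · obtain ⟨U, hU, ε, hε, h1⟩ := hV' x hm.1
      obtain ⟨U', hU', ε', hε', h2⟩ := hW' x hm.2
      exact ⟨U ∩ U', Filter.inter_mem hU hU', min ε ε', lt_min hε hε', Set.subset_inter
        ((conicNhd_mono Set.inter_subset_left (min_le_left _ _)).trans h1)
        ((conicNhd_mono Set.inter_subset_right (min_le_right _ _)).trans h2)⟩
  isOpen_sUnion := by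
    intro 𝒮 h𝒮
    refine ⟨fun x y t h hm => ?_, fun x hm => ?_⟩
    · obtain ⟨V, hV, hm⟩ := hm
      obtain ⟨A, hA, B, hB, T, hT, h1⟩ := (h𝒮 V hV).1 x y t h hm
      exact ⟨A, hA, B, hB, T, hT, h1.trans (Set.subset_sUnion_of_mem hV)⟩
    · obtain ⟨V, hV, hm⟩ := hm
      obtain ⟨U, hU, ε, hε, h1⟩ := (h𝒮 V hV).2 x hm
      exact ⟨U, hU, ε, hε, h1.trans (Set.subset_sUnion_of_mem hV)⟩

/-- The support of a point of `SJ(X)`: it is `{x}` for `x ∈ X`, and `{x, y}` for a point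
`[x, y; t]` outside `X` (which has only this one representation). -/
def supp (a : SqueezedJoin X) : Set X :=
  {z | a = incl z ∨ (a ∉ Set.range (incl : X → SqueezedJoin X) ∧
    ∃ (x y : X) (t : unitInterval), a = mk x y t ∧ (z = x ∨ z = y))}

theorem supp_incl (x : X) : supp (incl x) = {x} := by
  ext z
  constructor
  · rintro (h | ⟨h, -⟩)
    · exact (incl_injective h).symm
    · exact absurd ⟨x, rfl⟩ h
  · rintro rfl
    exact Or.inl rfl

end SqueezedJoin

/-- The iterated squeezed joins: `SJ^0(X) = X`, `SJ^(n+1)(X) = SJ(SJ^n(X))`. -/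
def SJPow (X : Type u) : ℕ → Type u
  | 0 => X
  | n + 1 => SqueezedJoin (SJPow X n)

namespace SJPow

instance instTopologicalSpace (X : Type u) [TopologicalSpace X] :
    ∀ n : ℕ, TopologicalSpace (SJPow X n)
  | 0 => inferInstanceAs (TopologicalSpace X)
  | n + 1 =>
    haveI : TopologicalSpace (SJPow X n) := instTopologicalSpace X n
    inferInstanceAs (TopologicalSpace (SqueezedJoin (SJPow X n)))

variable {X : Type u}

/-- The point `[a, b; t]` of `SJ^(n+1)(X)` for points `a`, `b` of `SJ^n(X)`. -/
def mk {n : ℕ} (a b : SJPow X n) (t : unitInterval) : SJPow X (n + 1) := SqueezedJoin.mk a b t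

/-- The inclusion of `SJ^n(X)` into `SJ^(n+1)(X)`. -/
def incl {n : ℕ} (a : SJPow X n) : SJPow X (n + 1) := SqueezedJoin.incl a

/-- The support in `X` of a point of `SJ^n(X)`: `supp a = {a}` for `a ∈ X = SJ^0(X)`, and for a
point `a` of `SJ^(n+1)(X)` the union of the supports of the points of `SJ^n(X)` that form the
support of `a` in the sense of a single squeezed join. -/
def supp : (n : ℕ) → SJPow X n → Set X
  | 0, a => {(show X from a)}
  | n + 1, a => ⋃ b ∈ SqueezedJoin.supp (X := SJPow X n) a, supp n b

theorem supp_incl {n : ℕ} (a : SJPow X n) : supp (n + 1) (incl a) = supp n a := by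
  show (⋃ b ∈ SqueezedJoin.supp (SqueezedJoin.incl a), supp n b) = supp n a
  rw [SqueezedJoin.supp_incl]
  simp

end SJPow

/-- The identification of each `SJ^n(X)` with a subset of `SJ^(n+1)(X)`. -/
inductive SJInftyRel (X : Type u) : (Σ n, SJPow X n) → (Σ n, SJPow X n) → Prop
  | incl (n : ℕ) (a : SJPow X n) : SJInftyRel X ⟨n, a⟩ ⟨n + 1, SJPow.incl a⟩

/-- `SJ^∞(X)` as a set: the union of the increasing sequence `X ⊆ SJ^1(X) ⊆ SJ^2(X) ⊆ …`. -/
def SJInfty (X : Type u) : Type u := Quot (SJInftyRel X)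

namespace SJInfty

variable {X : Type u}

/-- The inclusion `SJ^n(X) → SJ^∞(X)`. -/
def of (n : ℕ) (a : SJPow X n) : SJInfty X := Quot.mk _ ⟨n, a⟩

/-- The inclusion `X → SJ^∞(X)`. -/
def incl (x : X) : SJInfty X := of 0 x

/-- `U` is convex: for all sufficiently large `k`, it contains the segment `[a, b]` in
`SJ^(k+1)(X)` whenever it contains the points `a`, `b` of `SJ^k(X)`. -/
def IsConvex (U : Set (SJInfty X)) : Prop :=
  ∃ n : ℕ, ∀ k ≥ n, ∀ a b : SJPow X k, of k a ∈ U → of k b ∈ U →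
    ∀ t : unitInterval, of (k + 1) (SJPow.mk a b t) ∈ U

/-- The topology of `SJ^∞(X)`: its base consists of the convex sets that meet every `SJ^n(X)` in
an open set. (The intersection of two such sets is again such a set.) -/
instance [TopologicalSpace X] : TopologicalSpace (SJInfty X) :=
  TopologicalSpace.generateFrom {U | IsConvex U ∧ ∀ n : ℕ, IsOpen (of n ⁻¹' U)}

/-- The support in `X` of a point of `SJ^∞(X)`. -/
def supp : SJInfty X → Set X :=
  Quot.lift (fun a => SJPow.supp a.1 a.2) (by
    rintro _ _ ⟨n, a⟩
    exact (SJPow.supp_incl a).symm)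

end SJInfty

/-!
A stratification makes `Y` monotonically normal: open sets `H(U, x)` with `x ∈ H(U, x) ⊆ U` are
such that `H(U, x) ∩ H(V, y) ≠ ∅` implies `x ∈ V` or `y ∈ U`. For the sets `N x = H(Y \ X, x)` this
yields companions `r x ∈ X` that tend to `a ∈ X` when `N x` comes near `a`. The cover `N` of `Y \ X`
has an open refinement that splits into levels `k = 0, 1, …` of pairwise disjoint sets. If
`dim (Y \ X) ≤ n`, then Dowker's theorem followed by a barycentric subdivision of the nerve makes
the levels beyond `n` empty. On the level `k` the companion is a locally constant function, so
joining the companions of successive levels, with a partition of unity subordinate to the levels as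
weights, is continuous on `Y \ X`. It takes values in the join hull of the companions used, and as
convex open sets form a base of `SJ^∞(X)`, this forces continuity at the points of `X`.
-/

open Set Filter Topology TopologicalSpace

/-- The increasing form of a stratification: the open sets `part U n` exhaust `U` from inside,
monotonically in `U` and in `n`. -/
structure Stratification (Y : Type*) [TopologicalSpace Y] where
  part : Opens Y → ℕ → Opens Y
  closure_part_subset : ∀ U n, closure (part U n : Set Y) ⊆ U
  exists_mem_part : ∀ {U : Opens Y} {x : Y}, x ∈ U → ∃ n, x ∈ part U n
  part_mono : ∀ {U V : Opens Y} {m n : ℕ}, U ≤ V → m ≤ n → part U m ≤ part V n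

theorem IsStratifiable.nonempty_stratification {Y : Type u} [TopologicalSpace Y]
    (hY : IsStratifiable Y) : Nonempty (Stratification Y) := by
  obtain ⟨S, hcl, hun, hmono⟩ := hY.exists_stratification
  refine ⟨⟨fun U => partialSups (S U), fun U n => ?_, fun {U x} hx => ?_, fun {U V m n} hUV hmn =>
    ((partialSups (S U)).monotone hmn).trans (partialSups_mono (hmono U V hUV) n)⟩⟩
  · induction n with
    | zero => exact hcl U 0
    | succ n ih =>
      rw [partialSups_add_one, Opens.coe_sup, closure_union]
      exact union_subset ih (hcl U (n + 1))
  · obtain ⟨n, hn⟩ := mem_iUnion.1 ((hun U).superset hx)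
    exact ⟨n, le_partialSups (S U) n hn⟩

theorem IsStratifiable.of_isOpen {Y : Type u} [TopologicalSpace Y] (hY : IsStratifiable Y)
    {W : Set Y} (hW : IsOpen W) : IsStratifiable W := by
  obtain ⟨S, hcl, hun, hmono⟩ := hY.exists_stratification
  have := hY.t2
  let extend (U : Opens W) : Opens Y := ⟨Subtype.val '' (U : Set W),
    hW.isOpenMap_subtype_val _ U.isOpen⟩
  have preimage_extend (U : Opens W) : Subtype.val ⁻¹' (extend U : Set Y) = (U : Set W) :=
    preimage_image_eq _ Subtype.val_injective
  refine ⟨inferInstance, fun U n => ⟨Subtype.val ⁻¹' (S (extend U) n : Set Y),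
    (S (extend U) n).isOpen.preimage continuous_subtype_val⟩, fun U n => ?_, fun U => ?_,
    fun U V hUV n => preimage_mono (f := Subtype.val)
      (hmono (extend U) (extend V) (image_mono hUV) n)⟩
  · refine (continuous_subtype_val.closure_preimage_subset _).trans ?_
    exact (preimage_mono (hcl _ _)).trans (preimage_extend U).subset
  · conv_rhs => rw [← preimage_extend U, ← hun, preimage_iUnion]
    rfl

namespace Stratification

variable {Y : Type*} [TopologicalSpace Y] [T1Space Y] (S : Stratification Y)

/-- The least index at which `x` enters the exhaustion of `U`; it is the junk value `0` when
`x ∉ U`. -/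
noncomputable def level (U : Opens Y) (x : Y) : ℕ := sInf {n | x ∈ S.part U n}

/-- The neighbourhood of `x` in `U` that witnesses the monotone normality of a stratifiable space:
see `mem_of_mem_pointNhd`. -/
noncomputable def pointNhd (U : Opens Y) (x : Y) : Set Y :=
  S.part U (S.level U x) \ closure (S.part ⟨{x}ᶜ, isOpen_compl_singleton⟩ (S.level U x))

variable {S}

theorem isOpen_pointNhd {U : Opens Y} {x : Y} : IsOpen (S.pointNhd U x) :=
  (S.part U _).isOpen.sdiff isClosed_closure

theorem mem_pointNhd {U : Opens Y} {x : Y} (hx : x ∈ U) : x ∈ S.pointNhd U x :=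
  ⟨Nat.sInf_mem (S.exists_mem_part hx), fun h => S.closure_part_subset _ _ h rfl⟩

theorem pointNhd_subset {U : Opens Y} {x : Y} : S.pointNhd U x ⊆ U :=
  sdiff_subset.trans (subset_closure.trans (S.closure_part_subset U _))

theorem mem_of_mem_pointNhd {U V : Opens Y} {x y z : Y} (hzx : z ∈ S.pointNhd U x)
    (hzy : z ∈ S.pointNhd V y) (hle : S.level U x ≤ S.level V y) : y ∈ U := by
  by_contra hy
  have hUy : U ≤ ⟨{y}ᶜ, isOpen_compl_singleton⟩ := fun w hw hwy => hy (hwy ▸ hw)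
  exact hzy.2 (subset_closure (S.part_mono hUy hle hzx.1))

end Stratification

/-- An open refinement `⋃ₖ {D k i | i}` of the family `U` that covers the space, each level
`{D k i | i}` consisting of pairwise disjoint sets. -/
structure IsSigmaDisjointRefinement {Y ι : Type*} [TopologicalSpace Y] (D : ℕ → ι → Set Y)
    (U : ι → Set Y) : Prop where
  isOpen : ∀ k i, IsOpen (D k i)
  subset : ∀ k i, D k i ⊆ U i
  exists_mem : ∀ y, ∃ k i, y ∈ D k i
  disjoint : ∀ k, Pairwise fun i j => Disjoint (D k i) (D k j)

theorem IsSigmaDisjointRefinement.eq_of_mem {Y ι : Type*} [TopologicalSpace Y]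
    {D : ℕ → ι → Set Y} {U : ι → Set Y} (hD : IsSigmaDisjointRefinement D U) {k : ℕ} {i j : ι}
    {y : Y} (hi : y ∈ D k i) (hj : y ∈ D k j) : i = j :=
  (hD.disjoint k).eq (not_disjoint_iff.2 ⟨y, hi, hj⟩)

namespace Stratification

variable {Y ι : Type*} [TopologicalSpace Y]

/-- Each point is assigned to the first member of the cover containing it. -/
theorem exists_isSigmaDisjointRefinement [T1Space Y] (S : Stratification Y) {U : ι → Set Y}
    (hU : ∀ i, IsOpen (U i)) (hcov : ∀ y, ∃ i, y ∈ U i) :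
    ∃ D : ℕ → ι → Set Y, IsSigmaDisjointRefinement D U := by
  obtain ⟨_, _⟩ := exists_wellFoundedLT ι
  have hfirst : ∀ y, ∃ i, y ∈ U i ∧ ∀ j, y ∈ U j → i ≤ j := fun y =>
    exists_minimal_of_wellFoundedLT (y ∈ U ·) (hcov y) |>.imp fun i hi =>
      ⟨hi.prop, fun j hj => not_lt.1 (hi.not_lt hj)⟩
  choose first mem_first first_le using hfirst
  let V (i : ι) : Opens Y := ⟨U i, hU i⟩
  refine ⟨fun n i => ⋃ y ∈ {y | first y = i ∧ S.level (V i) y = n}, S.pointNhd (V i) y,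
    fun n i => isOpen_biUnion fun _ _ => isOpen_pointNhd,
    fun n i => iUnion₂_subset fun _ _ => pointNhd_subset,
    fun y => ⟨_, first y, mem_biUnion ⟨rfl, rfl⟩ (mem_pointNhd (mem_first y))⟩,
    fun n i j hij => disjoint_left.2 fun z hi hj => hij ?_⟩
  simp only [mem_iUnion, mem_ofPred_eq, exists_prop] at hi hj
  obtain ⟨x, ⟨rfl, hx⟩, hzx⟩ := hi
  obtain ⟨y, ⟨rfl, hy⟩, hzy⟩ := hj
  exact le_antisymm (first_le x _ (mem_of_mem_pointNhd hzy hzx (hy.trans hx.symm).le))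
    (first_le y _ (mem_of_mem_pointNhd hzx hzy (hx.trans hy.symm).le))

theorem exists_locallyFinite_refinement (S : Stratification Y) {V : ℕ → ι → Set Y}
    (hV : ∀ k i, IsOpen (V k i)) (hlf : ∀ k, LocallyFinite (V k)) (hcov : ∀ y, ∃ k i, y ∈ V k i) :
    ∃ R : ℕ × ι → Set Y, (∀ b, IsOpen (R b)) ∧ (⋃ b, R b) = univ ∧ LocallyFinite R ∧
      ∀ b, R b ⊆ V b.1 b.2 := by
  classical
  let O (k : ℕ) : Opens Y := ⟨⋃ i, V k i, isOpen_iUnion (hV k)⟩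
  refine ⟨fun b => V b.1 b.2 \ ⋃ j ∈ Iio b.1, closure (S.part (O j) b.1), fun b => (hV _ _).sdiff
      ((finite_Iio b.1).isClosed_biUnion fun _ _ => isClosed_closure),
    eq_univ_of_forall fun y => ?_, fun y => ?_, fun b => sdiff_subset⟩
  · obtain ⟨i, hi⟩ := Nat.find_spec (hcov y)
    refine mem_iUnion.2 ⟨(Nat.find (hcov y), i), hi, fun hy => ?_⟩
    obtain ⟨j, hj, hyj⟩ := mem_iUnion₂.1 hy
    exact Nat.find_min (hcov y) hj (mem_iUnion.1 (S.closure_part_subset _ _ hyj))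
  · obtain ⟨j, i, hji⟩ := hcov y
    obtain ⟨m, hm⟩ := S.exists_mem_part (U := O j) (mem_iUnion.2 ⟨i, hji⟩)
    choose M hM hMf using fun k => hlf k y
    let N := max m (j + 1)
    refine ⟨S.part (O j) m ∩ ⋂ k ∈ Iio N, M k, inter_mem ((S.part _ _).isOpen.mem_nhds hm)
      ((biInter_mem (finite_Iio N)).2 fun k _ => hM k),
      ((finite_Iio N).biUnion fun k _ => (hMf k).image (Prod.mk k)).subset ?_⟩
    rintro ⟨k, i⟩ ⟨z, ⟨hzV, hz⟩, hzm, hzM⟩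
    have hk : k < N := by
      by_contra! hk
      exact hz (mem_biUnion (show j < k by omega)
        (subset_closure (S.part_mono le_rfl (show m ≤ k by omega) hzm)))
    exact mem_biUnion hk ⟨i, ⟨z, hzV, mem_iInter₂.1 hzM k hk⟩, rfl⟩

theorem locallyFinite_inter_part (S : Stratification Y) {E : ι → Set Y} (hE : ∀ i, IsOpen (E i))
    (hd : Pairwise fun i j => Disjoint (E i) (E j)) {O : Opens Y} (hO : (O : Set Y) ⊆ ⋃ i, E i)
    (m : ℕ) :
    LocallyFinite fun i => E i ∩ S.part O m := by
  intro y
  by_cases hy : y ∈ closure (S.part O m : Set Y)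
  · obtain ⟨r, hr⟩ := mem_iUnion.1 (hO (S.closure_part_subset O m hy))
    refine ⟨E r, (hE r).mem_nhds hr, (finite_singleton r).subset ?_⟩
    rintro i ⟨z, ⟨hzi, -⟩, hzr⟩
    exact hd.eq (not_disjoint_iff.2 ⟨z, hzi, hzr⟩)
  · refine ⟨_, isClosed_closure.isOpen_compl.mem_nhds hy, finite_empty.subset ?_⟩
    rintro i ⟨z, ⟨-, hz⟩, hz'⟩
    exact hz' (subset_closure hz)

theorem paracompactSpace [T1Space Y] (S : Stratification Y) : ParacompactSpace Y := by
  refine ⟨fun ι U hU hcov => ?_⟩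
  obtain ⟨D, hD⟩ := S.exists_isSigmaDisjointRefinement hU (iUnion_eq_univ_iff.1 hcov)
  let O (n : ℕ) : Opens Y := ⟨⋃ i, D n i, isOpen_iUnion (hD.isOpen n)⟩
  let V (k : ℕ) (i : ι) : Set Y := D k.unpair.1 i ∩ S.part (O k.unpair.1) k.unpair.2
  have exists_mem_V (y : Y) : ∃ k i, y ∈ V k i := by
    obtain ⟨n, i, hi⟩ := hD.exists_mem y
    obtain ⟨m, hm⟩ := S.exists_mem_part (U := O n) (mem_iUnion.2 ⟨i, hi⟩)
    exact ⟨Nat.pair n m, i, by simpa [V] using ⟨hi, hm⟩⟩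
  obtain ⟨R, hR, hRc, hRl, hRV⟩ := S.exists_locallyFinite_refinement (V := V)
    (fun k i => (hD.isOpen _ i).inter (S.part _ _).isOpen)
    (fun k => S.locallyFinite_inter_part (hD.isOpen _) (hD.disjoint _) Subset.rfl _) exists_mem_V
  exact ⟨ℕ × ι, R, hR, hRc, hRl, fun b =>
    ⟨b.2, (hRV b).trans (inter_subset_left.trans (hD.subset _ _))⟩⟩

theorem exists_anticover [T1Space Y] (S : Stratification Y) {X : Set Y} (hX : IsClosed X)
    (hne : X.Nonempty) :
    ∃ (N : (Xᶜ : Set Y) → Set Y) (r : (Xᶜ : Set Y) → X),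
      (∀ x, IsOpen (N x)) ∧ (∀ x : (Xᶜ : Set Y), (x : Y) ∈ N x) ∧
      ∀ a : X, Tendsto (fun z : Y => r '' {x | z ∈ N x}) (𝓝 a) (𝓝 a).smallSets := by
  let W : Opens Y := ⟨Xᶜ, hX.isOpen_compl⟩
  have hcompanion (x : (Xᶜ : Set Y)) : ∃ r : X, ∀ a : X, ∀ U : Opens Y,
      (x : Y) ∈ S.pointNhd U a → (r : Y) ∈ U := by
    let A : Set ℕ := {m | ∃ (a : X) (U : Opens Y), (x : Y) ∈ S.pointNhd U a ∧ S.level U a = m}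
    have hA : BddAbove A := by
      refine ⟨S.level W x, ?_⟩
      rintro _ ⟨a, U, hxU, rfl⟩
      by_contra! hlt
      exact mem_of_mem_pointNhd (mem_pointNhd (U := W) x.2) hxU hlt.le a.2
    -- A point of `X` whose neighbourhood catches `x` as late as possible lies in all the others.
    rcases A.eq_empty_or_nonempty with hA' | hA'
    · exact ⟨⟨_, hne.some_mem⟩, fun a U hxU => (hA'.subset ⟨a, U, hxU, rfl⟩).elim⟩
    · obtain ⟨r, V, hxV, hr⟩ := Nat.sSup_mem hA' hA
      exact ⟨r, fun a U hxU => mem_of_mem_pointNhd hxU hxV (hr ▸ le_csSup hA ⟨a, U, hxU, rfl⟩)⟩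
  choose r hr using hcompanion
  refine ⟨fun x => S.pointNhd W x, r, fun x => isOpen_pointNhd, fun x => mem_pointNhd (U := W) x.2,
    fun a => tendsto_smallSets_iff.2 fun U hU => ?_⟩
  obtain ⟨V, hV, hVU⟩ := (mem_nhds_subtype X a U).1 hU
  obtain ⟨U', hU'V, hU', haU'⟩ := mem_nhds_iff.1 hV
  let B : Opens Y := ⟨S.pointNhd ⟨U', hU'⟩ a, isOpen_pointNhd⟩
  have haB : (a : Y) ∈ S.pointNhd B a := mem_pointNhd (mem_pointNhd haU')
  filter_upwards [isOpen_pointNhd.mem_nhds haB] with z hzB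
  rintro _ ⟨x, hzx, rfl⟩
  refine hVU (hU'V (hr x a ⟨U', hU'⟩ ?_))
  rcases le_total (S.level W x) (S.level B a) with hle | hle
  · exact absurd a.2 (mem_of_mem_pointNhd hzx hzB hle)
  · exact mem_of_mem_pointNhd hzB hzx hle

end Stratification

section CoveringDimension

variable {W κ : Type*} {n : ℕ}

theorem CoveringDimLE.exists_shrink_on {W : Type u} [TopologicalSpace W] (hn : CoveringDimLE W n)
    {P : Set W} (hP : IsClosed P) {L : κ → Set W} (hL : ∀ k, IsOpen (L k)) (hPL : P ⊆ ⋃ k, L k)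
    (hfin : {k | (L k ∩ P).Nonempty}.Finite) :
    ∃ H : κ → Set W, (∀ k, IsOpen (H k)) ∧ (∀ k, H k ⊆ L k) ∧ P ⊆ ⋃ k, H k ∧
      ∀ y, {k | y ∈ H k}.encard ≤ n + 1 := by
  have hcov : ⋃₀ insert Pᶜ (L '' {k | (L k ∩ P).Nonempty}) = univ := by
    refine eq_univ_of_forall fun y => ?_
    by_cases hy : y ∈ P
    · obtain ⟨k, hk⟩ := mem_iUnion.1 (hPL hy)
      exact ⟨L k, Or.inr ⟨k, ⟨y, hk, hy⟩, rfl⟩, hk⟩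
    · exact ⟨Pᶜ, Or.inl rfl, hy⟩
  obtain ⟨𝒱, -, h𝒱o, h𝒱c, h𝒱r, h𝒱n⟩ := hn _ ((hfin.image L).insert Pᶜ)
    (forall_mem_insert.2 ⟨hP.isOpen_compl, forall_mem_image.2 fun k _ => hL k⟩) hcov
  have hmember (V : {V // V ∈ 𝒱 ∧ (V ∩ P).Nonempty}) : ∃ k, V.1 ⊆ L k := by
    obtain ⟨V, hV, y, hyV, hyP⟩ := V
    obtain ⟨U, rfl | ⟨k, -, rfl⟩, hVU⟩ := h𝒱r V hV
    · exact absurd hyP (hVU hyV)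
    · exact ⟨k, hVU⟩
  choose c hcL using hmember
  refine ⟨fun k => ⋃ V ∈ c ⁻¹' {k}, V, fun k => isOpen_biUnion fun V _ => h𝒱o V V.2.1,
    fun k => iUnion₂_subset fun V hV => hV ▸ hcL V, fun y hy => ?_, fun y => ?_⟩
  · obtain ⟨V, hV, hyV⟩ := h𝒱c.superset (mem_univ y)
    exact mem_iUnion.2 ⟨c ⟨V, hV, y, hyV, hy⟩, mem_biUnion rfl hyV⟩
  · calc {k | y ∈ ⋃ V ∈ c ⁻¹' {k}, V.1}.encard ≤ (c '' {V | y ∈ V.1}).encard :=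
          encard_le_encard fun k hk => by
            obtain ⟨V, hV, hyV⟩ := mem_iUnion₂.1 hk
            exact ⟨V, hyV, hV⟩
      _ ≤ (Subtype.val '' {V : {V // V ∈ 𝒱 ∧ (V ∩ P).Nonempty} | y ∈ V.1}).encard :=
          (encard_image_le c _).trans_eq (Subtype.val_injective.encard_image _).symm
      _ ≤ {V | V ∈ 𝒱 ∧ y ∈ V}.encard := encard_le_encard (image_subset_iff.2 fun V hV =>
          ⟨V.2.1, hV⟩)
      _ ≤ n + 1 := h𝒱n y

theorem CoveringDimLE.exists_shrink_on_discrete {W ι : Type*} [TopologicalSpace W]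
    (hn : CoveringDimLE W n) {P : ι → Set W} (hP : ∀ i, IsClosed (P i)) (hPf : LocallyFinite P)
    (hPd : Pairwise fun i j => Disjoint (P i) (P j)) {L : κ → Set W} (hL : ∀ k, IsOpen (L k))
    (hcov : ⋃ k, L k = univ) (hfin : ∀ i, {k | (L k ∩ P i).Nonempty}.Finite) :
    ∃ L' : κ → Set W, (∀ k, IsOpen (L' k)) ∧ (∀ k, L' k ⊆ L k) ∧ ⋃ k, L' k = univ ∧
      ∀ i, ∀ y ∈ P i, {k | y ∈ L' k}.encard ≤ n + 1 := by
  choose H hHo hHL hHc hHn using fun i =>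
    hn.exists_shrink_on (hP i) hL (hcov.superset.trans' (subset_univ _)) (hfin i)
  refine ⟨fun k => L k \ ⋃ i, (P i \ H i k), fun k => (hL k).sdiff
    ((hPf.subset fun i => sdiff_subset).isClosed_iUnion fun i => (hP i).sdiff (hHo i k)),
    fun k => sdiff_subset, eq_univ_of_forall fun y => ?_, fun i y hy => ?_⟩
  · by_cases h : ∃ i, y ∈ P i
    · obtain ⟨i, hi⟩ := h
      obtain ⟨k, hk⟩ := mem_iUnion.1 (hHc i hi)
      refine mem_iUnion.2 ⟨k, hHL i k hk, fun hy => ?_⟩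
      obtain ⟨j, hj, hjk⟩ := mem_iUnion.1 hy
      obtain rfl : i = j := hPd.eq (not_disjoint_iff.2 ⟨y, hi, hj⟩)
      exact hjk hk
    · obtain ⟨k, hk⟩ := mem_iUnion.1 (hcov.superset (mem_univ y))
      exact mem_iUnion.2 ⟨k, hk, fun hy => h ((mem_iUnion.1 hy).imp fun i hi => hi.1)⟩
  · refine (encard_le_encard fun k hk => ?_).trans (hHn i y)
    by_contra hyk
    exact hk.2 (mem_iUnion.2 ⟨i, hy, hyk⟩)

theorem exists_continuous_forall_natCast_le [TopologicalSpace W] [NormalSpace W]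
    [ParacompactSpace W] {L : ℕ → Set W} (hL : LocallyFinite L) :
    ∃ φ : C(W, ℝ), ∀ y k, y ∈ L k → k ≤ φ y := by
  refine exists_continuous_forall_mem_convex_of_local_const
    (t := fun y => {c : ℝ | ∀ k, y ∈ L k → k ≤ c})
    (fun y a ha b hb s t hs ht hst k hk => ?_) fun y => ?_
  · exact convex_Ici (𝕜 := ℝ) (k : ℝ) (ha k hk) (hb k hk) hs ht hst
  · obtain ⟨O, hO, hfin⟩ := hL y
    obtain ⟨b, hb⟩ := hfin.bddAbove
    refine ⟨b, ?_⟩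
    filter_upwards [hO] with z hz k hk
    exact_mod_cast hb ⟨z, hk, hz⟩

theorem exists_slabs [TopologicalSpace W] [NormalSpace W] [ParacompactSpace W] {L : ℕ → Set W}
    (hL : LocallyFinite L) :
    ∃ P : ℤ → Set W, (∀ m, IsClosed (P m)) ∧ LocallyFinite P ∧ (∀ y, ∃ m, y ∈ P m) ∧
      (∀ m m', m + 1 < m' → Disjoint (P m) (P m')) ∧ ∀ m, {k | (L k ∩ P m).Nonempty}.Finite := by
  obtain ⟨φ, hφ⟩ := exists_continuous_forall_natCast_le hL
  have tendsto_add_one : Tendsto (fun m : ℤ => (m : ℝ) + 1) atBot atBot :=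
    tendsto_atBot_add_const_right _ 1 (tendsto_intCast_atBot_iff.2 tendsto_id)
  refine ⟨fun m => φ ⁻¹' Icc (m : ℝ) (m + 1), fun m => isClosed_Icc.preimage φ.continuous,
    (locallyFinite_Icc_of_tendsto tendsto_intCast_atTop_atTop tendsto_add_one).preimage_continuous
      φ.continuous, fun y => ⟨⌊φ y⌋, Int.floor_le _, (Int.lt_floor_add_one _).le⟩,
    fun m m' h => disjoint_left.2 fun y hy hy' => ?_,
    fun m => (finite_Iic (m + 1).toNat).subset ?_⟩
  · exact not_le.2 h (by exact_mod_cast hy'.1.trans hy.2)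
  · rintro k ⟨y, hyk, -, hy⟩
    have : (k : ℤ) ≤ m + 1 := by exact_mod_cast (hφ y k hyk).trans hy
    exact mem_Iic.2 (by lia)

/-- Dowker's theorem for countable covers. Of the slabs, those with even index are pairwise
disjoint, and so are those with odd index. -/
theorem CoveringDimLE.exists_shrink_nat {W : Type u} [TopologicalSpace W] [T2Space W]
    [ParacompactSpace W] (hn : CoveringDimLE W n) {L : ℕ → Set W} (hL : ∀ k, IsOpen (L k))
    (hcov : ⋃ k, L k = univ) :
    ∃ L' : ℕ → Set W, (∀ k, IsOpen (L' k)) ∧ (∀ k, L' k ⊆ L k) ∧ ⋃ k, L' k = univ ∧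
      ∀ y, {k | y ∈ L' k}.encard ≤ n + 1 := by
  obtain ⟨L₀, hL₀, hL₀c, hL₀f, hL₀L⟩ := precise_refinement L hL hcov
  obtain ⟨P, hP, hPf, hPc, hPd, hPfin⟩ := exists_slabs hL₀f
  have exists_shrink (i : ℤ) {L' : ℕ → Set W} (hL' : ∀ k, IsOpen (L' k))
      (hL'c : ⋃ k, L' k = univ) (hL'L : ∀ k, L' k ⊆ L₀ k) :=
    hn.exists_shrink_on_discrete (P := fun m => P (2 * m + i)) (fun m => hP _)
      (hPf.comp_injective fun a b h => by simpa using h)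
      (fun a b hab => by
        rcases hab.lt_or_gt with h | h
        · exact hPd _ _ (by lia)
        · exact (hPd _ _ (by lia)).symm)
      hL' hL'c fun m => (hPfin _).subset fun k hk => hk.mono (inter_subset_inter_left _ (hL'L k))
  obtain ⟨L₁, hL₁, hL₁L, hL₁c, hL₁n⟩ := exists_shrink 0 hL₀ hL₀c fun k => Subset.rfl
  obtain ⟨L₂, hL₂, hL₂L, hL₂c, hL₂n⟩ := exists_shrink 1 hL₁ hL₁c hL₁L
  refine ⟨L₂, hL₂, fun k => (hL₂L k).trans ((hL₁L k).trans (hL₀L k)), hL₂c, fun y => ?_⟩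
  obtain ⟨j, hy⟩ := hPc y
  obtain ⟨m, rfl | rfl⟩ := Int.even_or_odd' j
  · exact (encard_le_encard fun k hk => hL₂L k hk).trans (hL₁n m y (by simpa using hy))
  · exact hL₂n m y hy

end CoveringDimension

section BarycentricCell

variable {W ι : Type*} [TopologicalSpace W] {ρ : PartitionOfUnity ι W univ} {F F' : Finset ι}
  {y : W}

/-- The open star of the barycentre of the simplex `F` in the barycentric subdivision of the nerve,
pulled back along `ρ`: the barycentric coordinates in `F` are positive and exceed the others. -/
def barycentricCell (ρ : PartitionOfUnity ι W univ) (F : Finset ι) : Set W :=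
  {y | ∀ s ∈ F, 0 < ρ s y ∧ ∀ t ∉ F, ρ t y < ρ s y}

theorem isOpen_barycentricCell : IsOpen (barycentricCell ρ F) := by
  refine isOpen_iff_mem_nhds.2 fun y hy => ?_
  refine (F.eventually_all (p := fun s z => 0 < ρ s z ∧ ∀ t ∉ F, ρ t z < ρ s z)).2 fun s hs => ?_
  have hpos : ∀ᶠ z in 𝓝 y, 0 < ρ s z :=
    continuousAt_const.eventually_lt (ρ s).continuous.continuousAt (hy s hs).1
  have hlt : ∀ᶠ z in 𝓝 y, ∀ t ∈ ρ.fintsupport y, t ∉ F → ρ t z < ρ s z := by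
    refine (Finset.eventually_all _).2 fun t _ => eventually_imp_distrib_left.2 fun ht => ?_
    exact (ρ t).continuous.continuousAt.eventually_lt (ρ s).continuous.continuousAt
      ((hy s hs).2 t ht)
  filter_upwards [hpos, hlt, ρ.eventually_finsupport_subset y] with z hpos hlt hsupp
  refine ⟨hpos, fun t ht => ?_⟩
  by_cases htz : ρ t z = 0
  · rwa [htz]
  · exact hlt t (hsupp ((ρ.mem_finsupport z).2 htz)) ht

theorem eq_of_mem_barycentricCell (hcard : F.card = F'.card) (h : y ∈ barycentricCell ρ F)
    (h' : y ∈ barycentricCell ρ F') : F = F' := by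
  by_contra hne
  obtain ⟨s, hs, hs'⟩ := Finset.not_subset.1 (mt (Finset.eq_of_subset_of_card_le · hcard.ge) hne)
  obtain ⟨t, ht, ht'⟩ := Finset.not_subset.1
    (mt (Finset.eq_of_subset_of_card_le · hcard.le) (Ne.symm hne))
  exact lt_asymm ((h s hs).2 t ht') ((h' t ht).2 s hs')

theorem exists_mem_barycentricCell (ρ : PartitionOfUnity ι W univ) (y : W) :
    ∃ F : Finset ι, F.Nonempty ∧ y ∈ barycentricCell ρ F := by
  classical
  obtain ⟨s₀, hs₀⟩ := ρ.exists_pos (mem_univ y)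
  obtain ⟨m, hm, hmax⟩ := (ρ.finsupport y).exists_max_image (ρ · y)
    ⟨s₀, (ρ.mem_finsupport y).2 hs₀.ne'⟩
  have hmax (t : ι) : ρ t y ≤ ρ m y := by
    by_cases ht : ρ t y = 0
    · exact ht ▸ ρ.nonneg m y
    · exact hmax t ((ρ.mem_finsupport y).2 ht)
  refine ⟨{s ∈ ρ.finsupport y | ρ s y = ρ m y}, ⟨m, by simp [hm]⟩, fun s hs => ?_⟩
  have hsm : ρ s y = ρ m y := (Finset.mem_filter.1 hs).2
  rw [hsm]
  have hmpos : 0 < ρ m y := hs₀.trans_le (hmax s₀)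
  refine ⟨hmpos, fun t ht => (hmax t).lt_of_ne fun htm => ht ?_⟩
  exact Finset.mem_filter.2 ⟨(ρ.mem_finsupport y).2 (htm.trans_ne hmpos.ne'), htm⟩

/-- Barycentric subdivision of the nerve: the cells of the `k`-simplices form the `k`-th level. -/
theorem exists_isSigmaDisjointRefinement_le_encard [T2Space W] [ParacompactSpace W]
    {G : ι → Set W} (hG : ∀ s, IsOpen (G s)) (hcov : ⋃ s, G s = univ) :
    ∃ D : ℕ → ι → Set W, IsSigmaDisjointRefinement D G ∧
      ∀ k s, ∀ y ∈ D k s, (k : ℕ∞) + 1 ≤ {s | y ∈ G s}.encard := by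
  obtain ⟨ρ, hρ⟩ := PartitionOfUnity.exists_isSubordinate isClosed_univ G hG hcov.superset
  have subset_of_mem {F : Finset ι} {y : W} (hy : y ∈ barycentricCell ρ F) :
      (F : Set ι) ⊆ {s | y ∈ G s} :=
    fun s hs => hρ s (subset_tsupport _ (Function.mem_support.2 (hy s hs).1.ne'))
  let D (k : ℕ) (s : ι) : Set W :=
    {y | ∃ F : Finset ι, F.card = k + 1 ∧ (∃ h : F.Nonempty, h.choose = s) ∧
      y ∈ barycentricCell ρ F}
  refine ⟨D, ⟨fun k s => ?_, fun k s y hy => ?_, fun y => ?_, fun k s t hst => ?_⟩,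
    fun k s y hy => ?_⟩
  · simp only [D, ofPred_exists, ofPred_and]
    exact isOpen_iUnion fun F => isOpen_const.inter
      ((isOpen_iUnion fun _ => isOpen_const).inter isOpen_barycentricCell)
  · obtain ⟨F, -, ⟨hF, rfl⟩, hy⟩ := hy
    exact subset_of_mem hy hF.choose_spec
  · obtain ⟨F, hF, hy⟩ := exists_mem_barycentricCell ρ y
    exact ⟨F.card - 1, hF.choose, F, (Nat.sub_add_cancel hF.card_pos).symm, ⟨hF, rfl⟩, hy⟩
  · refine disjoint_left.2 ?_
    rintro y ⟨F, hF, ⟨hne, rfl⟩, hy⟩ ⟨F', hF', ⟨hne', rfl⟩, hy'⟩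
    obtain rfl := eq_of_mem_barycentricCell (hF.trans hF'.symm) hy hy'
    exact hst rfl
  · obtain ⟨F, hF, -, hy⟩ := hy
    calc (k : ℕ∞) + 1 = (F : Set ι).encard := by rw [encard_coe_eq_coe_finsetCard, hF]; norm_cast
      _ ≤ _ := encard_le_encard (subset_of_mem hy)

end BarycentricCell

theorem IsSigmaDisjointRefinement.exists_of_coveringDimLE {W : Type u} {ι : Type*}
    [TopologicalSpace W] [T2Space W] [ParacompactSpace W] {D : ℕ → ι → Set W} {G : ι → Set W}
    (hD : IsSigmaDisjointRefinement D G) {n : ℕ} (hn : CoveringDimLE W n) :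
    ∃ E : ℕ → ι → Set W, IsSigmaDisjointRefinement E G ∧ ∀ k i, (E k i).Nonempty → k ≤ n := by
  obtain ⟨L, hL, hLD, hLc, hLn⟩ := hn.exists_shrink_nat (L := fun k => ⋃ i, D k i)
    (fun k => isOpen_iUnion (hD.isOpen k))
    (iUnion_eq_univ_iff.2 fun y => (hD.exists_mem y).imp fun k => mem_iUnion.2)
  obtain ⟨C, hC, hCL⟩ := exists_isSigmaDisjointRefinement_le_encard hL hLc
  refine ⟨fun j i => ⋃ k, C j k ∩ D k i, ⟨fun j i => isOpen_iUnion fun k =>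
    (hC.isOpen j k).inter (hD.isOpen k i), fun j i => iUnion_subset fun k =>
    inter_subset_right.trans (hD.subset k i), fun y => ?_, fun j i i' hii' => ?_⟩, fun j i => ?_⟩
  · obtain ⟨j, k, hy⟩ := hC.exists_mem y
    obtain ⟨i, hi⟩ := mem_iUnion.1 (hLD k (hC.subset j k hy))
    exact ⟨j, i, mem_iUnion.2 ⟨k, hy, hi⟩⟩
  · simp only [disjoint_left, mem_iUnion, not_exists]
    rintro y ⟨k, hyk, hyi⟩ k' ⟨hyk', hyi'⟩
    obtain rfl := hC.eq_of_mem hyk hyk'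
    exact hii' (hD.eq_of_mem hyi hyi')
  · rintro ⟨y, hy⟩
    obtain ⟨k, hyk, -⟩ := mem_iUnion.1 hy
    exact_mod_cast (ENat.add_le_add_iff_right ENat.one_ne_top).1 ((hCL j k y hyk).trans (hLn y))

theorem IsStratifiable.exists_isSigmaDisjointRefinement {W : Type u} {ι : Type*}
    [TopologicalSpace W] (hW : IsStratifiable W) {G : ι → Set W} (hG : ∀ i, IsOpen (G i))
    (hcov : ∀ y, ∃ i, y ∈ G i) :
    ∃ D : ℕ → ι → Set W, IsSigmaDisjointRefinement D G ∧
      ∀ n, CoveringDimLE W n → ∀ k i, (D k i).Nonempty → k ≤ n := by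
  have := hW.t2
  obtain ⟨S⟩ := hW.nonempty_stratification
  have := S.paracompactSpace
  obtain ⟨D, hD⟩ := S.exists_isSigmaDisjointRefinement hG hcov
  by_cases h : ∃ n, CoveringDimLE W n
  · classical
    obtain ⟨E, hE, hEn⟩ := hD.exists_of_coveringDimLE (Nat.find_spec h)
    exact ⟨E, hE, fun n hn k i hki => (hEn k i hki).trans (Nat.find_min' h hn)⟩
  · exact ⟨D, hD, fun n hn => absurd ⟨n, hn⟩ h⟩

/-- A Dugundji system for the closed set `X`: a partition of unity on the complement of `X` together
with a vertex in `X` for each weight, moving continuously where the weight lives, such that the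
vertices in use near a point of `X` converge to that point. -/
structure DugundjiSystem {Y : Type*} [TopologicalSpace Y] (X : Set Y) where
  weight : PartitionOfUnity ℕ (Xᶜ : Set Y)
  vertex : ℕ → (Xᶜ : Set Y) → X
  continuousAt_vertex : ∀ k, ∀ y ∈ tsupport (weight k), ContinuousAt (vertex k) y
  tendsto_vertex : ∀ a : X, Tendsto (fun y => (vertex · y) '' weight.fintsupport y)
    (comap (↑) (𝓝 (a : Y))) (𝓝 a).smallSets

theorem IsStratifiable.exists_dugundjiSystem {Y : Type u} [TopologicalSpace Y]
    (hY : IsStratifiable Y) {X : Set Y} (hX : IsClosed X) (hne : X.Nonempty) :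
    ∃ S : DugundjiSystem X, ∀ n, CoveringDimLE (Xᶜ : Set Y) n → ∀ k > n, S.weight k = 0 := by
  have := hY.t2
  obtain ⟨S⟩ := hY.nonempty_stratification
  obtain ⟨N, r, hN, mem_N, hr⟩ := S.exists_anticover hX hne
  have hW : IsStratifiable (Xᶜ : Set Y) := hY.of_isOpen hX.isOpen_compl
  obtain ⟨D, hD, hDn⟩ := hW.exists_isSigmaDisjointRefinement
    (fun x => (hN x).preimage continuous_subtype_val) fun y => ⟨y, mem_N y⟩
  have index_exists (k : ℕ) (y : (Xᶜ : Set Y)) : ∃ x, ∀ x', y ∈ D k x' → x = x' := by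
    by_cases h : ∃ x, y ∈ D k x
    · exact h.imp fun x hx x' hx' => hD.eq_of_mem hx hx'
    · exact ⟨y, fun x' hx' => absurd ⟨x', hx'⟩ h⟩
  choose index index_eq using index_exists
  obtain ⟨T⟩ := hW.nonempty_stratification
  have := T.paracompactSpace
  obtain ⟨ρ, hρ⟩ := PartitionOfUnity.exists_isSubordinate isClosed_univ (fun k => ⋃ x, D k x)
    (fun k => isOpen_iUnion (hD.isOpen k))
    fun y _ => mem_iUnion.2 ((hD.exists_mem y).imp fun k => mem_iUnion.2)
  refine ⟨⟨ρ, fun k y => r (index k y), fun k y hy => ?_, fun a => ?_⟩, fun n hn k hk => ?_⟩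
  · obtain ⟨x, hx⟩ := mem_iUnion.1 (hρ k hy)
    refine (continuousAt_const (y := r x)).congr ?_
    filter_upwards [(hD.isOpen k x).mem_nhds hx] with z hz
    rw [index_eq k z x hz]
  · refine ((hr a).comp tendsto_comap).smallSets_mono (Eventually.of_forall fun y => ?_)
    rintro _ ⟨k, hk, rfl⟩
    obtain ⟨x, hx⟩ := mem_iUnion.1 (hρ k ((ρ.mem_fintsupport_iff y k).1 hk))
    exact ⟨index k y, index_eq k y x hx ▸ hD.subset k x hx, rfl⟩
  · ext y
    by_contra hy
    obtain ⟨x, hx⟩ := mem_iUnion.1 (hρ k (subset_tsupport _ hy))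
    exact not_le.2 hk (hDn n hn k x ⟨y, hx⟩)

namespace SqueezedJoin

variable {X : Type u}

theorem mk_zero (x y : X) : mk x y 0 = incl x := Quot.sound (SqueezedJoinRel.left x y x)

theorem mk_one (x y : X) : mk x y 1 = incl y :=
  (Quot.sound (SqueezedJoinRel.right x y y)).trans (Quot.sound (SqueezedJoinRel.diag y 1 0))

open Classical in
/-- The set of the one or two points of `X` that are needed to represent a point of `SJ(X)`. Unlike
`supp`, it is computed from an arbitrary representative. -/
noncomputable def endpoints : SqueezedJoin X → Set X :=
  Quot.lift (fun p => if p.2.2 = 0 then {p.1} else if p.2.2 = 1 then {p.2.1} else {p.1, p.2.1}) (by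
    rintro _ _ (⟨x, y, y'⟩ | ⟨x, x', y⟩ | ⟨x, t, t'⟩) <;> simp)

theorem endpoints_incl (x : X) : endpoints (incl x) = {x} := by
  simp [endpoints, incl, mk]

theorem endpoints_mk {t : unitInterval} (h0 : t ≠ 0) (h1 : t ≠ 1) (x y : X) :
    endpoints (mk x y t) = {x, y} := by
  simp [endpoints, mk, h0, h1]

theorem endpoints_mk_subset (x y : X) (t : unitInterval) : endpoints (mk x y t) ⊆ {x, y} := by
  by_cases h0 : t = 0
  · simp [h0, mk_zero, endpoints_incl]
  by_cases h1 : t = 1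
  · simp [h1, mk_one, endpoints_incl]
  · exact (endpoints_mk h0 h1 x y).subset

theorem supp_subset_endpoints (a : SqueezedJoin X) : supp a ⊆ endpoints a := by
  rintro z (rfl | ⟨ha, x, y, t, rfl, hz⟩)
  · exact (endpoints_incl z).superset rfl
  · have h0 : t ≠ 0 := fun h0 => ha ⟨x, by rw [h0, mk_zero]⟩
    have h1 : t ≠ 1 := fun h1 => ha ⟨y, by rw [h1, mk_one]⟩
    exact (endpoints_mk h0 h1 x y).superset hz

theorem mk_eq_incl {x y z : X} {t : unitInterval} (h : mk x y t = incl z) :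
    (t = 0 ∧ x = z) ∨ (t = 1 ∧ y = z) ∨ (x = z ∧ y = z) := by
  by_cases h0 : t = 0
  · exact Or.inl ⟨h0, incl_injective ((mk_zero x y).symm.trans (h0 ▸ h))⟩
  by_cases h1 : t = 1
  · exact Or.inr (Or.inl ⟨h1, incl_injective ((mk_one x y).symm.trans (h1 ▸ h))⟩)
  have hxy : ({x, y} : Set X) = {z} := by
    rw [← endpoints_mk h0 h1, h, endpoints_incl]
  exact Or.inr (Or.inr ⟨hxy.subset (Or.inl rfl), hxy.subset (Or.inr rfl)⟩)

section Tendsto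

variable [TopologicalSpace X] {Z : Type*} {l : Filter Z} {p q : Z → X} {t : Z → unitInterval}
  {x y : X} {s : unitInterval}

theorem exists_conicNhd_subset {O : Set (SqueezedJoin X)} (hO : O ∈ 𝓝 (incl x)) :
    ∃ U ∈ 𝓝 x, ∃ ε : ℝ, 0 < ε ∧ conicNhd U ε ⊆ O := by
  obtain ⟨V, hVO, hV, hx⟩ := mem_nhds_iff.1 hO
  obtain ⟨U, hU, ε, hε, hUV⟩ := hV.2 x hx
  exact ⟨U, hU, ε, hε, hUV.trans hVO⟩

theorem tendsto_mk_left (hp : Tendsto p l (𝓝 x)) (ht : Tendsto t l (𝓝 0)) :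
    Tendsto (fun w => mk (p w) (q w) (t w)) l (𝓝 (incl x)) := by
  refine fun O hO => mem_map.2 ?_
  obtain ⟨U, hU, ε, hε, hUO⟩ := exists_conicNhd_subset hO
  have ht : ∀ᶠ w in l, (t w : ℝ) < ε :=
    ((continuous_subtype_val.tendsto 0).comp ht).eventually_lt_const hε
  filter_upwards [hp hU, ht] with w hpw htw
  exact hUO (Or.inl (Or.inr ⟨p w, hpw, q w, mem_univ _, t w, htw, rfl⟩))

theorem tendsto_mk_right (hq : Tendsto q l (𝓝 y)) (ht : Tendsto t l (𝓝 1)) :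
    Tendsto (fun w => mk (p w) (q w) (t w)) l (𝓝 (incl y)) := by
  refine fun O hO => mem_map.2 ?_
  obtain ⟨U, hU, ε, hε, hUO⟩ := exists_conicNhd_subset hO
  have ht : ∀ᶠ w in l, 1 - ε < (t w : ℝ) :=
    ((continuous_subtype_val.tendsto 1).comp ht).eventually_const_lt (sub_lt_self 1 hε)
  filter_upwards [hq hU, ht] with w hqw htw
  exact hUO (Or.inr ⟨p w, mem_univ _, q w, hqw, t w, htw, rfl⟩)

theorem tendsto_mk_diag (hp : Tendsto p l (𝓝 x)) (hq : Tendsto q l (𝓝 x)) :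
    Tendsto (fun w => mk (p w) (q w) (t w)) l (𝓝 (incl x)) := by
  refine fun O hO => mem_map.2 ?_
  obtain ⟨U, hU, ε, -, hUO⟩ := exists_conicNhd_subset hO
  filter_upwards [hp hU, hq hU] with w hpw hqw
  exact hUO (Or.inl (Or.inl ⟨p w, hpw, q w, hqw, t w, mem_univ _, rfl⟩))

theorem tendsto_mk (hp : Tendsto p l (𝓝 x)) (hq : Tendsto q l (𝓝 y)) (ht : Tendsto t l (𝓝 s)) :
    Tendsto (fun w => mk (p w) (q w) (t w)) l (𝓝 (mk x y s)) := by
  by_cases h : mk x y s ∈ range incl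
  · obtain ⟨z, hz⟩ := h
    rw [← hz]
    rcases mk_eq_incl hz.symm with ⟨rfl, rfl⟩ | ⟨rfl, rfl⟩ | ⟨rfl, rfl⟩
    exacts [tendsto_mk_left hp ht, tendsto_mk_right hq ht, tendsto_mk_diag hp hq]
  · refine fun O hO => mem_map.2 ?_
    obtain ⟨V, hVO, hV, hxy⟩ := mem_nhds_iff.1 hO
    obtain ⟨A, hA, B, hB, T, hT, hABT⟩ := hV.1 x y s h hxy
    filter_upwards [hp hA, hq hB, ht hT] with w hpw hqw htw
    exact hVO (hABT ⟨p w, hpw, q w, hqw, t w, htw, rfl⟩)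

theorem continuous_incl : Continuous (incl : X → SqueezedJoin X) :=
  continuous_iff_continuousAt.2 fun _ => tendsto_mk_diag tendsto_id tendsto_id

theorem continuousAt_mk [TopologicalSpace Z] {z : Z} (hp : t z = 1 ∨ ContinuousAt p z)
    (hq : t z = 0 ∨ ContinuousAt q z) (ht : ContinuousAt t z) :
    ContinuousAt (fun w => mk (p w) (q w) (t w)) z := by
  by_cases h0 : t z = 0
  · rw [ContinuousAt, h0] at ht ⊢
    exact mk_zero (p z) (q z) ▸ tendsto_mk_left (hp.resolve_left (by simp [h0])) ht
  by_cases h1 : t z = 1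
  · rw [ContinuousAt, h1] at ht ⊢
    exact mk_one (p z) (q z) ▸ tendsto_mk_right (hq.resolve_left h0) ht
  · exact tendsto_mk (hp.resolve_left h1) (hq.resolve_left h0) ht

end Tendsto

end SqueezedJoin

namespace SJPow

variable {X : Type u} {V : Set X} {k : ℕ}

/-- The inclusion `X → SJ^k(X)`. -/
def vertex (x : X) : ∀ k, SJPow X k
  | 0 => x
  | k + 1 => incl (vertex x k)

theorem continuous_vertex [TopologicalSpace X] : ∀ k, Continuous fun x : X => vertex x k
  | 0 => continuous_id
  | k + 1 => SqueezedJoin.continuous_incl.comp (continuous_vertex k)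

/-- The points of `SJ^k(X)` that are formed from points of `V`. -/
def hull (V : Set X) : ∀ k, Set (SJPow X k)
  | 0 => V
  | k + 1 => {c | ∃ a ∈ hull V k, ∃ b ∈ hull V k, ∃ t, c = mk a b t}

theorem mk_mem_hull {a b : SJPow X k} (ha : a ∈ hull V k) (hb : b ∈ hull V k)
    (t : unitInterval) : mk a b t ∈ hull V (k + 1) := ⟨a, ha, b, hb, t, rfl⟩

theorem incl_mem_hull {a : SJPow X k} (ha : a ∈ hull V k) : incl a ∈ hull V (k + 1) :=
  mk_mem_hull ha ha 0

theorem vertex_mem_hull {x : X} (hx : x ∈ V) : ∀ k, vertex x k ∈ hull V k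
  | 0 => hx
  | k + 1 => incl_mem_hull (vertex_mem_hull hx k)

theorem supp_subset_of_mem_hull : ∀ {k : ℕ} {c : SJPow X k}, c ∈ hull V k → supp k c ⊆ V
  | 0, _, hc => singleton_subset_iff.2 hc
  | k + 1, _, ⟨a, ha, b, hb, t, rfl⟩ => by
    refine iUnion₂_subset fun d hd => ?_
    rcases SqueezedJoin.endpoints_mk_subset a b t (SqueezedJoin.supp_subset_endpoints _ hd) with
      rfl | rfl
    · exact supp_subset_of_mem_hull ha
    · exact supp_subset_of_mem_hull hb

theorem exists_hull_subset [TopologicalSpace X] (x : X) : ∀ {k : ℕ} {O : Set (SJPow X k)},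
    O ∈ 𝓝 (vertex x k) → ∃ V ∈ 𝓝 x, hull V k ⊆ O
  | 0, O, hO => ⟨O, hO, Subset.rfl⟩
  | k + 1, O, hO => by
    obtain ⟨U, hU, ε, -, hUO⟩ := SqueezedJoin.exists_conicNhd_subset hO
    obtain ⟨V, hV, hVU⟩ := exists_hull_subset x hU
    refine ⟨V, hV, ?_⟩
    rintro _ ⟨a, ha, b, hb, t, rfl⟩
    exact hUO (Or.inl (Or.inl ⟨a, hVU ha, b, hVU hb, t, mem_univ _, rfl⟩))

/-- The share of `σ k` in `σ 0 + … + σ k`, which is the last parameter of the iterated join with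
weights `σ`. The projection to `[0, 1]` only makes it total: it acts on negative weights. -/
noncomputable def lastShare (σ : ℕ → ℝ) (k : ℕ) : unitInterval :=
  projIcc 0 1 zero_le_one (σ k / ∑ i ∈ Finset.range (k + 1), σ i)

theorem lastShare_eq_zero {σ : ℕ → ℝ} (h : σ k = 0) : lastShare σ k = 0 := by
  rw [lastShare, h, zero_div, projIcc_left]
  rfl

theorem lastShare_eq_one {σ : ℕ → ℝ} (h : σ k ≠ 0) (hsum : ∑ i ∈ Finset.range k, σ i = 0) :
    lastShare σ k = 1 := by
  rw [lastShare, Finset.sum_range_succ, hsum, zero_add, div_self h, projIcc_right]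
  rfl

theorem continuousAt_lastShare {Z : Type*} [TopologicalSpace Z] {σ : ℕ → Z → ℝ} {z : Z}
    (hσ : ∀ i, ContinuousAt (σ i) z) (hsum : ∑ i ∈ Finset.range (k + 1), σ i z ≠ 0) :
    ContinuousAt (fun w => lastShare (σ · w) k) z :=
  continuous_projIcc.continuousAt.comp
    ((hσ k).div (tendsto_finsetSum _ fun i _ => hσ i) hsum)

/-- The iterated join of the points `p 0, p 1, …, p k` with (unnormalised) weights
`σ 0, …, σ k`. -/
noncomputable def combo (σ : ℕ → ℝ) (p : ℕ → X) : ∀ k, SJPow X k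
  | 0 => p 0
  | k + 1 => mk (combo σ p k) (vertex (p (k + 1)) k) (lastShare σ (k + 1))

theorem combo_succ_of_eq_zero {σ : ℕ → ℝ} (p : ℕ → X) (h : σ (k + 1) = 0) :
    combo σ p (k + 1) = incl (combo σ p k) := by
  rw [combo, lastShare_eq_zero h]
  exact SqueezedJoin.mk_zero _ _

theorem combo_mem_hull {σ : ℕ → ℝ} {p : ℕ → X} (hσ : ∀ i, 0 ≤ σ i) (hV : ∀ i, 0 < σ i → p i ∈ V) :
    ∀ k, 0 < ∑ i ∈ Finset.range (k + 1), σ i → combo σ p k ∈ hull V k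
  | 0, h => hV 0 (by simpa only [zero_add, Finset.sum_range_one] using h)
  | k + 1, h => by
    rcases (hσ (k + 1)).eq_or_lt with hlast | hlast
    · rw [combo_succ_of_eq_zero p hlast.symm]
      refine incl_mem_hull (combo_mem_hull hσ hV k ?_)
      rwa [Finset.sum_range_succ, ← hlast, add_zero] at h
    have hvertex := vertex_mem_hull (hV _ hlast) k
    rcases (Finset.sum_nonneg fun i _ => hσ i).eq_or_lt with hsum | hsum
    · have hcombo : combo σ p (k + 1) = incl (vertex (p (k + 1)) k) := by
        rw [combo, lastShare_eq_one hlast.ne' hsum.symm]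
        exact SqueezedJoin.mk_one _ _
      exact hcombo ▸ incl_mem_hull hvertex
    · exact mk_mem_hull (combo_mem_hull hσ hV k hsum) hvertex _

theorem continuousAt_combo [TopologicalSpace X] {Z : Type*} [TopologicalSpace Z] {z : Z}
    {σ : ℕ → Z → ℝ} {p : ℕ → Z → X} (hσ : ∀ i, 0 ≤ σ i z) (hσc : ∀ i, ContinuousAt (σ i) z)
    (hp : ∀ i, 0 < σ i z → ContinuousAt (p i) z) :
    ∀ k, 0 < ∑ i ∈ Finset.range (k + 1), σ i z →
      ContinuousAt (fun w => combo (σ · w) (p · w) k) z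
  | 0, h => hp 0 (by simpa only [zero_add, Finset.sum_range_one] using h)
  | k + 1, h => by
    refine SqueezedJoin.continuousAt_mk (X := SJPow X k) ?_ ?_ (continuousAt_lastShare hσc h.ne')
    · rcases (Finset.sum_nonneg fun i _ => hσ i).eq_or_lt with hsum | hsum
      · rw [Finset.sum_range_succ, ← hsum, zero_add] at h
        exact Or.inl (lastShare_eq_one h.ne' hsum.symm)
      · exact Or.inr (continuousAt_combo hσ hσc hp k hsum)
    · rcases (hσ (k + 1)).eq_or_lt with hlast | hlast
      · exact Or.inl (lastShare_eq_zero hlast.symm)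
      · exact Or.inr ((continuous_vertex k).continuousAt.comp (hp _ hlast))

end SJPow

namespace SJInfty

variable {X : Type u} {V : Set X} {σ : ℕ → ℝ} {p : ℕ → X} {k : ℕ}

theorem of_incl (a : SJPow X k) : of (k + 1) (SJPow.incl a) = of k a :=
  (Quot.sound (SJInftyRel.incl k a)).symm

theorem of_vertex (x : X) : ∀ k, of k (SJPow.vertex x k) = incl x
  | 0 => rfl
  | k + 1 => (of_incl _).trans (of_vertex x k)

theorem continuous_of [TopologicalSpace X] (k : ℕ) : Continuous (of k : SJPow X k → SJInfty X) :=
  continuous_generateFrom_iff.2 fun _ hU => hU.2 k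

/-- The join hull of `V`: the points of `SJ^∞(X)` that are formed from points of `V`. -/
def hull (V : Set X) : Set (SJInfty X) := ⋃ k, of k '' SJPow.hull V k

theorem of_mem_hull {a : SJPow X k} (ha : a ∈ SJPow.hull V k) : of k a ∈ hull V :=
  mem_iUnion.2 ⟨k, mem_image_of_mem _ ha⟩

theorem incl_mem_hull {x : X} (hx : x ∈ V) : incl x ∈ hull V := of_mem_hull (k := 0) hx

theorem supp_subset_of_mem_hull {c : SJInfty X} (hc : c ∈ hull V) : supp c ⊆ V := by
  obtain ⟨k, a, ha, rfl⟩ := mem_iUnion.1 hc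
  exact SJPow.supp_subset_of_mem_hull ha

theorem hull_subset_of_forall_ge {U : Set (SJInfty X)} {n : ℕ}
    (h : ∀ k ≥ n, ∀ a ∈ SJPow.hull V k, of k a ∈ U) : hull V ⊆ U := by
  have descend : ∀ j k, n ≤ k + j → ∀ a ∈ SJPow.hull V k, of k a ∈ U := by
    intro j
    induction j with
    | zero => exact h
    | succ j ih =>
      intro k hk a ha
      exact of_incl a ▸ ih (k + 1) (by lia) _ (SJPow.incl_mem_hull ha)
  refine iUnion_subset fun k => ?_
  rintro _ ⟨a, ha, rfl⟩
  exact descend n k (by lia) a ha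

theorem exists_hull_subset [TopologicalSpace X] {U : Set (SJInfty X)} (hU : IsConvex U)
    (hUo : ∀ n : ℕ, IsOpen (of n ⁻¹' U)) {x : X} (hx : incl x ∈ U) : ∃ V ∈ 𝓝 x, hull V ⊆ U := by
  obtain ⟨n, hn⟩ := hU
  have hxn : SJPow.vertex x n ∈ of n ⁻¹' U := by rwa [mem_preimage, of_vertex]
  obtain ⟨V, hV, hVU⟩ := SJPow.exists_hull_subset x ((hUo n).mem_nhds hxn)
  refine ⟨V, hV, hull_subset_of_forall_ge (n := n) fun k hk => ?_⟩
  induction k, hk using Nat.le_induction with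
  | base => exact hVU
  | succ k hk ih =>
    rintro _ ⟨a, ha, b, hb, t, rfl⟩
    exact hn k hk a b (ih a ha) (ih b hb) t

theorem tendsto_incl_of_forall_mem_hull [TopologicalSpace X] {Z : Type*} {l : Filter Z}
    {f : Z → SJInfty X} {x : X} (h : ∀ V ∈ 𝓝 x, ∀ᶠ z in l, f z ∈ hull V) :
    Tendsto f l (𝓝 (incl x)) := by
  refine tendsto_nhds_generateFrom_iff.2 fun U hU hx => ?_
  obtain ⟨V, hV, hVU⟩ := exists_hull_subset hU.1 hU.2 hx
  exact (h V hV).mono fun z hz => hVU hz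

/-- The iterated join of the points `p i` with (unnormalised) weights `σ i`, only finitely many of
which are nonzero. For infinitely many nonzero weights the supremum, and so the value, is junk. -/
noncomputable def combo (σ : ℕ → ℝ) (p : ℕ → X) : SJInfty X :=
  of _ (SJPow.combo σ p (sSup (Function.support σ)))

theorem combo_eq_of (p : ℕ → X) (h : ∀ i > k, σ i = 0) :
    combo σ p = of k (SJPow.combo σ p k) := by
  have hk : k ∈ upperBounds (Function.support σ) := fun i hi => not_lt.1 fun hik => hi (h i hik)
  have hstable (m : ℕ) (hm : sSup (Function.support σ) ≤ m) :
      of m (SJPow.combo σ p m) = combo σ p := by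
    induction m, hm using Nat.le_induction with
    | base => rfl
    | succ m hm ih =>
      have hzero : σ (m + 1) = 0 := by_contra fun hne =>
        ((le_csSup ⟨k, hk⟩ (Function.mem_support.2 hne)).trans hm).not_gt m.lt_succ_self
      rw [SJPow.combo_succ_of_eq_zero p hzero, of_incl, ih]
  exact (hstable k (csSup_le' hk)).symm

theorem sum_range_pos (hσ : ∀ i, 0 ≤ σ i) (hpos : ∃ i, 0 < σ i) (h : ∀ i > k, σ i = 0) :
    0 < ∑ i ∈ Finset.range (k + 1), σ i := by
  obtain ⟨i, hi⟩ := hpos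
  have hik : i ≤ k := not_lt.1 fun hki => hi.ne' (h i hki)
  exact Finset.sum_pos' (fun i _ => hσ i) ⟨i, Finset.mem_range_succ_iff.2 hik, hi⟩

theorem combo_mem_hull (hσ : ∀ i, 0 ≤ σ i) (hpos : ∃ i, 0 < σ i) (h : ∀ i > k, σ i = 0)
    (hV : ∀ i, 0 < σ i → p i ∈ V) : combo σ p ∈ hull V := by
  rw [combo_eq_of p h]
  exact of_mem_hull (SJPow.combo_mem_hull hσ hV k (sum_range_pos hσ hpos h))

theorem continuousAt_combo [TopologicalSpace X] {Z : Type*} [TopologicalSpace Z] {z : Z}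
    {σ : ℕ → Z → ℝ} {p : ℕ → Z → X} (hσ : ∀ i, 0 ≤ σ i z) (hpos : ∃ i, 0 < σ i z)
    (h : ∀ᶠ w in 𝓝 z, ∀ i > k, σ i w = 0) (hσc : ∀ i, ContinuousAt (σ i) z)
    (hp : ∀ i, 0 < σ i z → ContinuousAt (p i) z) :
    ContinuousAt (fun w => combo (σ · w) (p · w)) z := by
  have hcombo : ContinuousAt (fun w => of k (SJPow.combo (σ · w) (p · w) k)) z :=
    (continuous_of k).continuousAt.comp
      (SJPow.continuousAt_combo hσ hσc hp k (sum_range_pos hσ hpos h.self_of_nhds))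
  exact hcombo.congr (h.mono fun w hw => (combo_eq_of _ hw).symm)

end SJInfty

namespace DugundjiSystem

variable {Y : Type u} [TopologicalSpace Y] {X : Set Y} (S : DugundjiSystem X)

open Classical in
/-- The finite subset of `X` that controls the extension at a point: the vertices whose weights do
not vanish identically near that point, and the point itself if it lies in `X`. -/
noncomputable def carrier (y : Y) : Finset X :=
  if h : y ∈ X then {⟨y, h⟩} else (S.weight.fintsupport ⟨y, h⟩).image (S.vertex · ⟨y, h⟩)

open Classical in
/-- The extension to `Y` of the inclusion `X → SJ^∞(X)`: off `X`, the iterated join of the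
vertices. -/
noncomputable def extension (y : Y) : SJInfty X :=
  if h : y ∈ X then SJInfty.incl ⟨y, h⟩
  else SJInfty.combo (S.weight · ⟨y, h⟩) (S.vertex · ⟨y, h⟩)

theorem carrier_coe (x : X) : S.carrier x = {x} := dif_pos x.2

theorem coe_carrier_of_compl (y : (Xᶜ : Set Y)) :
    (S.carrier y : Set X) = (S.vertex · y) '' S.weight.fintsupport y := by
  classical rw [carrier, dif_neg y.2, Finset.coe_image]

theorem extension_coe (x : X) : S.extension x = SJInfty.incl x := dif_pos x.2

theorem extension_of_compl (y : (Xᶜ : Set Y)) :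
    S.extension y = SJInfty.combo (S.weight · y) (S.vertex · y) := dif_neg y.2

theorem eventually_weight_eq_zero (y : (Xᶜ : Set Y)) :
    ∃ k, ∀ᶠ z in 𝓝 y, ∀ i > k, S.weight i z = 0 := by
  refine ⟨(S.weight.fintsupport y).sup id, ?_⟩
  filter_upwards [S.weight.eventually_finsupport_subset y] with z hz i hi
  by_contra hne
  exact (Finset.le_sup (f := id) (hz ((S.weight.mem_finsupport z).2 hne))).not_gt hi

theorem vertex_mem_carrier {y : (Xᶜ : Set Y)} {i : ℕ} (hi : 0 < S.weight i y) :
    S.vertex i y ∈ (S.carrier y : Set X) := by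
  rw [coe_carrier_of_compl]
  exact mem_image_of_mem _ (S.weight.finsupport_subset_fintsupport y
    ((S.weight.mem_finsupport y).2 hi.ne'))

theorem extension_mem_hull {y : Y} {V : Set X} (hV : (S.carrier y : Set X) ⊆ V) :
    S.extension y ∈ SJInfty.hull V := by
  by_cases hy : y ∈ X
  · lift y to X using hy
    rw [carrier_coe, Finset.coe_singleton, singleton_subset_iff] at hV
    exact S.extension_coe y ▸ SJInfty.incl_mem_hull hV
  · lift y to (Xᶜ : Set Y) using hy
    obtain ⟨k, hk⟩ := S.eventually_weight_eq_zero y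
    rw [extension_of_compl]
    exact SJInfty.combo_mem_hull (S.weight.nonneg · y) (S.weight.exists_pos (mem_univ y))
      hk.self_of_nhds fun i hi => hV (S.vertex_mem_carrier hi)

theorem eventually_carrier_subset_of_mem {U : Set X} (hU : IsOpen U) {a : X} (ha : a ∈ U) :
    ∀ᶠ y : Y in 𝓝 (a : Y), (S.carrier y : Set X) ⊆ U := by
  obtain ⟨U', hU', rfl⟩ := isOpen_induced_iff.1 hU
  have hvertex := (S.tendsto_vertex a).eventually
    (eventually_smallSets_subset.2 (hU.mem_nhds ha))
  filter_upwards [hU'.mem_nhds ha, eventually_comap.1 hvertex] with y hyU hy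
  by_cases hyX : y ∈ X
  · lift y to X using hyX
    rwa [carrier_coe, Finset.coe_singleton, singleton_subset_iff]
  · lift y to (Xᶜ : Set Y) using hyX
    exact S.coe_carrier_of_compl y ▸ hy y rfl

theorem eventually_carrier_subset_of_compl {U : Set X} (hU : IsOpen U) {y : (Xᶜ : Set Y)}
    (hy : (S.carrier y : Set X) ⊆ U) : ∀ᶠ z : (Xᶜ : Set Y) in 𝓝 y, (S.carrier z : Set X) ⊆ U := by
  rw [coe_carrier_of_compl, image_subset_iff] at hy
  have hvertex : ∀ᶠ z in 𝓝 y, ∀ i ∈ S.weight.fintsupport y, S.vertex i z ∈ U :=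
    (eventually_all_finset _).2 fun i hi =>
      (S.continuousAt_vertex i y ((S.weight.mem_fintsupport_iff y i).1 hi)).eventually_mem
        (hU.mem_nhds (hy hi))
  filter_upwards [hvertex, S.weight.eventually_fintsupport_subset y] with z hzU hzy
  rw [coe_carrier_of_compl, image_subset_iff]
  exact fun i hi => hzU i (hzy hi)

theorem isOpen_setOf_carrier_subset (hX : IsClosed X) (U : Set X) (hU : IsOpen U) :
    IsOpen {y : Y | (S.carrier y : Set X) ⊆ U} := by
  refine isOpen_iff_mem_nhds.2 fun y hy => ?_
  by_cases hyX : y ∈ X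
  · lift y to X using hyX
    refine S.eventually_carrier_subset_of_mem hU (hy ?_)
    rw [carrier_coe, Finset.coe_singleton, mem_singleton_iff]
  · lift y to (Xᶜ : Set Y) using hyX
    rw [← hX.isOpen_compl.isOpenEmbedding_subtypeVal.map_nhds_eq y]
    exact S.eventually_carrier_subset_of_compl hU hy

theorem continuous_extension (hX : IsClosed X) : Continuous S.extension := by
  refine continuous_iff_continuousAt.2 fun y => ?_
  by_cases hy : y ∈ X
  · lift y to X using hy
    rw [ContinuousAt, extension_coe]
    refine SJInfty.tendsto_incl_of_forall_mem_hull fun V hV => ?_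
    filter_upwards [S.eventually_carrier_subset_of_mem isOpen_interior
      (mem_interior_iff_mem_nhds.2 hV)] with z hz
    exact S.extension_mem_hull (hz.trans interior_subset)
  · lift y to (Xᶜ : Set Y) using hy
    rw [← hX.isOpen_compl.isOpenEmbedding_subtypeVal.continuousAt_iff]
    obtain ⟨k, hk⟩ := S.eventually_weight_eq_zero y
    have hcombo : ContinuousAt (fun z => SJInfty.combo (S.weight · z) (S.vertex · z)) y :=
      SJInfty.continuousAt_combo (S.weight.nonneg · y) (S.weight.exists_pos (mem_univ y)) hk
        (fun i => (S.weight i).continuous.continuousAt)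
        fun i hi => S.continuousAt_vertex i y (subset_tsupport _ hi.ne')
    exact hcombo.congr (.of_forall fun z => (S.extension_of_compl z).symm)

theorem supp_extension_subset (y : Y) : SJInfty.supp (S.extension y) ⊆ S.carrier y :=
  SJInfty.supp_subset_of_mem_hull (S.extension_mem_hull Subset.rfl)

theorem range_extension_subset {n : ℕ} (hn : ∀ k > n, S.weight k = 0) :
    range S.extension ⊆ range (SJInfty.of n) := by
  rintro _ ⟨y, rfl⟩
  by_cases hy : y ∈ X
  · lift y to X using hy
    exact ⟨SJPow.vertex y n, (SJInfty.of_vertex y n).trans (S.extension_coe y).symm⟩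
  · lift y to (Xᶜ : Set Y) using hy
    rw [extension_of_compl, SJInfty.combo_eq_of _ fun i hi => DFunLike.congr_fun (hn i hi) y]
    exact mem_range_self _

end DugundjiSystem

theorem lemma3p1 {Y : Type u} [TopologicalSpace Y] (hY : IsStratifiable Y)
    (X : Set Y) (hX : IsClosed X) (hne : X.Nonempty) :
    ∃ (f : Y → SJInfty X) (u : Y → Finset X),
      Continuous f ∧
      (∀ x : X, f x = SJInfty.incl x) ∧
      (∀ U : Set X, IsOpen U → IsOpen {y : Y | (u y : Set X) ⊆ U}) ∧
      (∀ x : X, u x = {x}) ∧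
      (∀ y : Y, SJInfty.supp (f y) ⊆ (u y : Set X)) ∧
      (∀ n : ℕ, CoveringDimLE (Xᶜ : Set Y) n → Set.range f ⊆ Set.range (SJInfty.of (X := X) n)) := by
  obtain ⟨S, hdim⟩ := hY.exists_dugundjiSystem hX hne
  exact ⟨S.extension, S.carrier, S.continuous_extension hX, S.extension_coe,
    S.isOpen_setOf_carrier_subset hX, S.carrier_coe, S.supp_extension_subset,
    fun n hn => S.range_extension_subset (hdim n hn)⟩
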